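/- Let $\mathbb K$ be $\mathbb R$ or $\mathbb C$, and let $\ell_1=\ell_1(\mathbb Z_+)$ be the Banach space of absolutely summable sequences in $\mathbb K$ indexed by the non-negative integers, with canonical basis $\{e_n\}_{n\ge 0}$. Let $T:\ell_1\to\ell_1$ be the backward weighted shift with weight sequence $w_n=1/n$, $n\ge 1$, that is, the bounded linear operator with $Te_0=0$ and $Te_n=\frac1n e_{n-1}$ for $n\ge 1$. Then for every $\lambda\in\mathbb K\setminus\{0\}$ the operator $I+\lambda T$ satisfies the Kitai Criterion. Here a bounded linear operator $A$ on a Banach space $X$ satisfies the Kitai Criterion if there exist two dense subsets $E$ and $F$ of $X$ and a map $S:F\to F$ such that $ASy=y$, $S^ky\to 0$ and $A^kx\to 0$ as $k\to\infty$ for all $y\in F$ and $x\in E$. -/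

import Mathlib

open Filter Topology

/-- A bounded linear operator `T` on a normed space `X` satisfies the Kitai Criterion if there are
dense subsets `E`, `F` of `X` and a map `S : F → F` such that `T (S y) = y`, `S ^ k y → 0` and
`T ^ k x → 0` as `k → ∞`, for all `y ∈ F` and `x ∈ E`. -/
def SatisfiesKitaiCriterion {𝕜 X : Type*} [RCLike 𝕜] [NormedAddCommGroup X] [NormedSpace 𝕜 X]
    (T : X →L[𝕜] X) : Prop :=
  ∃ (E F : Set X) (S : F → F), Dense E ∧ Dense F ∧
    (∀ y : F, T (S y : X) = (y : X)) ∧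
    (∀ y : F, Tendsto (fun k : ℕ => ((S^[k] y : F) : X)) atTop (𝓝 0)) ∧
    (∀ x ∈ E, Tendsto (fun k : ℕ => (T ^ k) x) atTop (𝓝 0))

/-- The space `ℓ₁ = ℓ₁(ℤ₊)` of absolutely summable sequences `x₀, x₁, x₂, …` in `𝕜`. -/
abbrev EllOne (𝕜 : Type*) [RCLike 𝕜] : Type _ := lp (fun _ : ℕ => 𝕜) 1

section BackwardShift

variable {𝕜 : Type*} [RCLike 𝕜]

theorem EllOne.summable_norm (x : EllOne 𝕜) : Summable fun n : ℕ => ‖x n‖ := by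
  simpa using (memℓp_gen_iff (by simp)).1 (lp.memℓp x)

theorem EllOne.norm_eq (x : EllOne 𝕜) : ‖x‖ = ∑' n : ℕ, ‖x n‖ := by
  simpa using lp.norm_eq_tsum_rpow (p := 1) (by simp) x

theorem EllOne.summable_shift (w : ℕ → 𝕜) {C : ℝ} (hC : ∀ n, 1 ≤ n → ‖w n‖ ≤ C)
    (x : EllOne 𝕜) : Summable fun n : ℕ => ‖w (n + 1) * x (n + 1)‖ := by
  refine Summable.of_nonneg_of_le (fun _ => norm_nonneg _) (fun n => ?_)
    (((summable_nat_add_iff 1).2 (EllOne.summable_norm x)).mul_left C)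
  rw [norm_mul]
  exact mul_le_mul_of_nonneg_right (hC (n + 1) (by omega)) (norm_nonneg _)

/-- The coordinate form of the backward weighted shift on `ℓ₁`, as a linear map:
`(T x)ₙ = wₙ₊₁ xₙ₊₁`. The value `w 0` is not used. -/
def backwardShiftLinear (w : ℕ → 𝕜) (hw : ∃ C : ℝ, ∀ n, 1 ≤ n → ‖w n‖ ≤ C) :
    EllOne 𝕜 →ₗ[𝕜] EllOne 𝕜 where
  toFun x := ⟨fun n => w (n + 1) * x (n + 1), by
    obtain ⟨C, hC⟩ := hw
    refine (memℓp_gen_iff (by simp)).2 ?_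
    simpa using EllOne.summable_shift w hC x⟩
  map_add' x y := by
    ext n
    exact mul_add _ _ _
  map_smul' c x := by
    ext n
    exact mul_left_comm _ _ _

/-- The backward weighted shift on `ℓ₁` with the bounded weight sequence `w₁, w₂, …`:
the bounded operator `T` with `T e₀ = 0` and `T eₙ = wₙ eₙ₋₁` for `n ≥ 1`
(see `backwardShift_single_zero` and `backwardShift_single_succ`). -/
noncomputable def backwardShift (w : ℕ → 𝕜) (hw : ∃ C : ℝ, ∀ n, 1 ≤ n → ‖w n‖ ≤ C) :
    EllOne 𝕜 →L[𝕜] EllOne 𝕜 :=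
  (backwardShiftLinear w hw).mkContinuousOfExistsBound (by
    obtain ⟨C, hC⟩ := hw
    refine ⟨C, fun x => ?_⟩
    have hC0 : 0 ≤ C := (norm_nonneg _).trans (hC 1 le_rfl)
    rw [EllOne.norm_eq, EllOne.norm_eq]
    have h1 : ∑' n : ℕ, ‖w (n + 1) * x (n + 1)‖ ≤ ∑' n : ℕ, C * ‖x (n + 1)‖ := by
      refine (EllOne.summable_shift w hC x).tsum_le_tsum (fun n => ?_)
        (((summable_nat_add_iff 1).2 (EllOne.summable_norm x)).mul_left C)
      rw [norm_mul]
      exact mul_le_mul_of_nonneg_right (hC (n + 1) (by omega)) (norm_nonneg _)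
    refine h1.trans ?_
    rw [tsum_mul_left, (EllOne.summable_norm x).tsum_eq_zero_add]
    exact mul_le_mul_of_nonneg_left (le_add_of_nonneg_left (norm_nonneg _)) hC0)

theorem backwardShift_apply (w : ℕ → 𝕜) (hw : ∃ C : ℝ, ∀ n, 1 ≤ n → ‖w n‖ ≤ C)
    (x : EllOne 𝕜) (n : ℕ) : backwardShift w hw x n = w (n + 1) * x (n + 1) := rfl

theorem backwardShift_single_zero (w : ℕ → 𝕜) (hw : ∃ C : ℝ, ∀ n, 1 ≤ n → ‖w n‖ ≤ C) :
    backwardShift w hw (lp.single 1 0 (1 : 𝕜)) = 0 := by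
  ext n
  simp [backwardShift_apply]

theorem backwardShift_single_succ (w : ℕ → 𝕜) (hw : ∃ C : ℝ, ∀ n, 1 ≤ n → ‖w n‖ ≤ C) (n : ℕ) :
    backwardShift w hw (lp.single 1 (n + 1) (1 : 𝕜)) = w (n + 1) • lp.single 1 n (1 : 𝕜) := by
  ext m
  rw [backwardShift_apply]
  by_cases h : m = n
  · subst h
    simp
  · simp [h]

end BackwardShift

theorem one_div_weights_bounded (𝕜 : Type*) [RCLike 𝕜] :
    ∃ C : ℝ, ∀ n : ℕ, 1 ≤ n → ‖(1 / (n : 𝕜))‖ ≤ C := by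
  refine ⟨1, fun n hn => ?_⟩
  rw [norm_div, norm_one, RCLike.norm_natCast]
  exact (div_le_one (by exact_mod_cast hn)).2 (by exact_mod_cast hn)

/-! ### Conjugation by exponentials under `t * b - b * t = t * t`. -/

section Exponential

/-! Write `t` for `λT` and `b` for `λB`, with `B` the unweighted backward shift. Since `1/(n+1) -
1/(n+2) = 1/((n+1)(n+2))`, `t * b - b * t = t * t`. This forces `(1 + t) e^b (1 - t) = e^b`, so `e^b
(1 - t) e^(-b)` is a right inverse of `1 + t`, similar to `1 - t`. The Kitai Criterion thus reduces
to one statement for both `λ` and `-λ`: a dense set of vectors has null orbits under `1 - λT`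
(`dense_tendsto_one_sub_smul_harmonicShift_pow`).

For that, choose `|ω| = 1` with `λω = |λ| = c`. On the sequences `ω^n ∫₀ᵃ t^n P(a - t) dt`,
integration by parts turns `1 - λT` into `1 - cV` acting on `P`, where `V` is the Volterra operator.
Starting from `P = cX`, the iterates are rescaled Laguerre-type polynomials, which are `O(k^(-1/2))`
uniformly on `[0, a]` (`sq_eval_laguerreIntegral_le`). The starting vectors, for `0 < a < 1`, are
multiples of `(ω^n a^n / ((n+1)(n+2)))`, and letting `a → 0` repeatedly extracts every basis vector
(`EllOne.eq_top_of_geomTail_mem`). -/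

theorem mul_pow_of_commutator_eq_sq {R : Type*} [Ring R] {t b : R} (h : t * b - b * t = t * t)
    (n : ℕ) : t * b ^ (n + 1) = b ^ (n + 1) * t + (n + 1) • (t * b ^ n * t) := by
  have hb : t * b = b * t + t * t := by rw [← h]; abel
  induction n with
  | zero => simp [hb]
  | succ n ih =>
    calc t * b ^ (n + 2) = t * b ^ (n + 1) * b := by rw [pow_succ b (n + 1), mul_assoc]
      _ = b ^ (n + 1) * (t * b) + (n + 1) • (t * b ^ n * (t * b)) := by
        rw [ih, add_mul, smul_mul_assoc, mul_assoc, mul_assoc (t * b ^ n)]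
      _ = b ^ (n + 2) * t + (n + 1) • (t * b ^ (n + 1) * t)
          + (b ^ (n + 1) * t + (n + 1) • (t * b ^ n * t)) * t := by
        rw [hb, mul_add, mul_add, smul_add, add_mul, smul_mul_assoc, pow_succ b (n + 1),
          pow_succ b n]
        simp only [mul_assoc]
        abel
      -- The bracket is the induction hypothesis read backwards; it supplies the one missing copy of
      -- `t * b ^ (n + 1) * t`.
      _ = _ := by rw [← ih, succ_nsmul _ (n + 1)]; abel

variable {A : Type*} [NormedRing A] [NormedAlgebra ℚ A] [CompleteSpace A]

/-- The power identity summed over the exponential series: `(n + 1) / (n + 1)! = 1 / n!` turns its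
last term into the series of `t * exp b * t`. -/
theorem mul_exp_of_commutator_eq_sq {t b : A} (h : t * b - b * t = t * t) :
    t * NormedSpace.exp b = NormedSpace.exp b * t + t * NormedSpace.exp b * t := by
  have hs := NormedSpace.exp_series_hasSum_exp' (𝕂 := ℚ) b
  have h1 := hs.mul_left t
  have h2 := hs.mul_right t
  have h3 := h1.mul_right t
  have h4 : HasSum (fun n : ℕ => t * ((((n + 1).factorial : ℚ)⁻¹) • b ^ (n + 1)))
      (t * NormedSpace.exp b - t) := by
    simpa using (hasSum_nat_add_iff' 1).2 h1
  have h5 : HasSum (fun n : ℕ => ((((n + 1).factorial : ℚ)⁻¹) • b ^ (n + 1)) * t)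
      (NormedSpace.exp b * t - t) := by
    simpa using (hasSum_nat_add_iff' 1).2 h2
  have h6 : t * NormedSpace.exp b - t = NormedSpace.exp b * t - t + t * NormedSpace.exp b * t := by
    refine h4.unique ((h5.add h3).congr_fun fun n => ?_)
    have hn : ((n + 1 : ℕ) : ℚ) ≠ 0 := by positivity
    rw [mul_smul_comm, mul_pow_of_commutator_eq_sq h, smul_add, smul_mul_assoc, mul_smul_comm,
      smul_mul_assoc, ← Nat.cast_smul_eq_nsmul ℚ, smul_smul, Nat.factorial_succ, Nat.cast_mul,
      mul_inv_rev, mul_assoc, inv_mul_cancel₀ hn, mul_one]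
  rwa [sub_add_eq_add_sub, sub_left_inj] at h6

theorem one_add_mul_conj_exp_of_commutator_eq_sq {t b : A} (h : t * b - b * t = t * t) :
    (1 + t) * (NormedSpace.exp b * (1 - t) * NormedSpace.exp (-b)) = 1 := by
  have h1 : (1 + t) * (NormedSpace.exp b * (1 - t)) = NormedSpace.exp b := by
    have := mul_exp_of_commutator_eq_sq h
    have h2 : (1 + t) * (NormedSpace.exp b * (1 - t)) =
      NormedSpace.exp b + (t * NormedSpace.exp b
        - (NormedSpace.exp b * t + t * NormedSpace.exp b * t)) := by noncomm_ring
    rw [h2, ← this, sub_self, add_zero]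
  rw [← mul_assoc, h1, ← NormedSpace.exp_add_of_commute (Commute.refl b).neg_right]
  simp

theorem exp_neg_mul_exp (b : A) : NormedSpace.exp (-b) * NormedSpace.exp b = 1 := by
  rw [← NormedSpace.exp_add_of_commute (Commute.refl b).neg_left]
  simp

theorem mul_pow_conj {R : Type*} [Monoid R] {m m' : R} (h : m' * m = 1) (a : R) (k : ℕ) :
    (m * a * m') ^ k * m = m * a ^ k := by
  induction k with
  | zero => simp
  | succ k ih => rw [pow_succ', mul_assoc, ih, pow_succ', mul_assoc (m * a), ← mul_assoc m', h,
      one_mul, mul_assoc]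

end Exponential

/-! ### Reduction of the criterion to two dense sets of null orbits. -/

section Kitai

variable {𝕜 X : Type*} [RCLike 𝕜] [NormedAddCommGroup X] [NormedSpace 𝕜 X]

theorem SatisfiesKitaiCriterion.of_rightInverse {T R : X →L[𝕜] X} (h : T * R = 1)
    (hT : Dense {x | Tendsto (fun k : ℕ => (T ^ k) x) atTop (𝓝 0)})
    (hR : Dense {x | Tendsto (fun k : ℕ => (R ^ k) x) atTop (𝓝 0)}) :
    SatisfiesKitaiCriterion T := by
  let S : {x | Tendsto (fun k : ℕ => (R ^ k) x) atTop (𝓝 0)} →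
      {x | Tendsto (fun k : ℕ => (R ^ k) x) atTop (𝓝 0)} := fun y => ⟨R y, by
    have := (tendsto_add_atTop_iff_nat 1).2 y.2
    simp only [pow_succ] at this
    exact this⟩
  have hS : ∀ (k : ℕ) y, ((S^[k] y : _) : X) = (R ^ k) y := by
    intro k
    induction k with
    | zero => intro y; rfl
    | succ k ih => intro y; rw [Function.iterate_succ_apply, ih, pow_succ]; rfl
  refine ⟨_, _, S, hT, hR, fun y => ?_, fun y => ?_, fun x hx => hx⟩
  · exact DFunLike.congr_fun h (y : X)
  · simp only [hS]
    exact y.2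

theorem SatisfiesKitaiCriterion.one_add_of_commutator_eq_sq [CompleteSpace X] {t b : X →L[𝕜] X}
    (h : t * b - b * t = t * t)
    (hadd : Dense {x | Tendsto (fun k : ℕ => ((1 + t) ^ k) x) atTop (𝓝 0)})
    (hsub : Dense {x | Tendsto (fun k : ℕ => ((1 - t) ^ k) x) atTop (𝓝 0)}) :
    SatisfiesKitaiCriterion (1 + t) := by
  let : NormedAlgebra ℚ (X →L[𝕜] X) := NormedAlgebra.restrictScalars ℚ 𝕜 _
  refine .of_rightInverse (one_add_mul_conj_exp_of_commutator_eq_sq h) hadd ?_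
  have hsurj : Function.Surjective (NormedSpace.exp b : X →L[𝕜] X) := fun x =>
    ⟨NormedSpace.exp (-b) x, DFunLike.congr_fun (by simpa using exp_neg_mul_exp (-b)) x⟩
  -- The similarity `exp b` maps null orbits of `1 - t` to null orbits of the right inverse; being
  -- surjective and continuous, it preserves density.
  refine (hsurj.denseRange.dense_image (NormedSpace.exp b).continuous hsub).mono ?_
  rintro _ ⟨x, hx, rfl⟩
  have := ((NormedSpace.exp b).continuous.tendsto 0).comp hx
  rw [map_zero] at this
  refine this.congr fun k => ?_
  exact (DFunLike.congr_fun (mul_pow_conj (exp_neg_mul_exp b) (1 - t) k) x).symm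

end Kitai

/-! ### Density of geometrically damped sequences. -/

section Density

variable {𝕜 : Type*} [RCLike 𝕜]

theorem memℓp_one_of_norm_le_geometric {f : ℕ → 𝕜} {C r : ℝ} (hr₀ : 0 ≤ r) (hr : r < 1)
    (hf : ∀ n, ‖f n‖ ≤ C * r ^ n) : Memℓp f 1 := by
  refine (memℓp_gen_iff (by simp)).2 ?_
  simpa using Summable.of_nonneg_of_le (fun n => norm_nonneg (f n)) hf
    ((summable_geometric_of_lt_one hr₀ hr).mul_left C)

theorem EllOne.norm_le_of_norm_le_geometric {x : EllOne 𝕜} {C r : ℝ} (hr₀ : 0 ≤ r) (hr : r < 1)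
    (hx : ∀ n, ‖x n‖ ≤ C * r ^ n) : ‖x‖ ≤ C * (1 - r)⁻¹ := by
  rw [EllOne.norm_eq, ← tsum_geometric_of_lt_one hr₀ hr, ← tsum_mul_left]
  exact (EllOne.summable_norm x).tsum_le_tsum hx
    ((summable_geometric_of_lt_one hr₀ hr).mul_left C)

/-- The vector with entries `u j * a ^ (j - n)` for `j ≥ n`, and `0` before. -/
def geomTail (u : ℕ → 𝕜) (hu : ∀ j, ‖u j‖ ≤ 1) (a : ℝ) (ha₀ : 0 < a) (ha : a < 1) (n : ℕ) :
    EllOne 𝕜 :=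
  ⟨fun j => if j < n then 0 else u j * (a : 𝕜) ^ (j - n), by
    refine memℓp_one_of_norm_le_geometric (C := (a ^ n)⁻¹) ha₀.le ha fun j => ?_
    split_ifs with h
    · rw [norm_zero]; positivity
    · rw [norm_mul, norm_pow, RCLike.norm_ofReal, abs_of_pos ha₀,
        pow_sub₀ _ ha₀.ne' (not_lt.1 h), mul_comm (a ^ j)]
      exact mul_le_of_le_one_left (by positivity) (hu j)⟩

theorem geomTail_apply (u : ℕ → 𝕜) (hu : ∀ j, ‖u j‖ ≤ 1) (a : ℝ) (ha₀ : 0 < a) (ha : a < 1)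
    (n j : ℕ) :
    geomTail u hu a ha₀ ha n j = if j < n then 0 else u j * (a : 𝕜) ^ (j - n) := rfl

theorem norm_geomTail_le (u : ℕ → 𝕜) (hu : ∀ j, ‖u j‖ ≤ 1) (a : ℝ) (ha₀ : 0 < a) (ha : a < 1)
    (n : ℕ) : ‖geomTail u hu a ha₀ ha n‖ ≤ (1 - a)⁻¹ := by
  rw [EllOne.norm_eq, ← (EllOne.summable_norm _).sum_add_tsum_nat_add n,
    Finset.sum_eq_zero (fun j hj => by
      rw [geomTail_apply, if_pos (Finset.mem_range.1 hj), norm_zero]), zero_add,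
    ← tsum_geometric_of_lt_one ha₀.le ha]
  refine ((summable_nat_add_iff n).2 (EllOne.summable_norm _)).tsum_le_tsum (fun j => ?_)
    (summable_geometric_of_lt_one ha₀.le ha)
  rw [geomTail_apply, if_neg (by omega), norm_mul, norm_pow, RCLike.norm_ofReal, abs_of_pos ha₀,
    Nat.add_sub_cancel]
  exact mul_le_of_le_one_left (by positivity) (hu _)

theorem geomTail_sub_single (u : ℕ → 𝕜) (hu : ∀ j, ‖u j‖ ≤ 1) (a : ℝ) (ha₀ : 0 < a) (ha : a < 1)
    (n : ℕ) : geomTail u hu a ha₀ ha n - u n • lp.single 1 n (1 : 𝕜) =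
      (a : 𝕜) • geomTail u hu a ha₀ ha (n + 1) := by
  ext j
  rw [lp.coeFn_sub, Pi.sub_apply, lp.coeFn_smul, lp.coeFn_smul, Pi.smul_apply, Pi.smul_apply,
    lp.single_apply, geomTail_apply, geomTail_apply, smul_eq_mul, smul_eq_mul]
  rcases lt_trichotomy j n with h | rfl | h
  · simp [h, h.ne, Nat.lt_succ_of_lt h]
  · simp
  · rw [if_neg (by omega), if_neg (by omega), Pi.single_eq_of_ne h.ne', mul_zero, sub_zero,
      show j - n = j - (n + 1) + 1 by omega, pow_succ]
    ring

/-- As `a → 0` the tail from `n` converges to `u n` times the `n`-th basis vector. Subtracting that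
vector and dividing by `a` leaves the tail from `n + 1`, so induction yields the whole basis. -/
theorem EllOne.eq_top_of_geomTail_mem (u : ℕ → 𝕜) (hu : ∀ j, ‖u j‖ ≤ 1) (hu₀ : ∀ j, u j ≠ 0)
    (G : Submodule 𝕜 (EllOne 𝕜)) (hG : IsClosed (G : Set (EllOne 𝕜)))
    (h : ∀ (a : ℝ) (ha₀ : 0 < a) (ha : a < 1), geomTail u hu a ha₀ ha 0 ∈ G) : G = ⊤ := by
  have key : ∀ n, (∀ (a : ℝ) (ha₀ : 0 < a) (ha : a < 1), geomTail u hu a ha₀ ha n ∈ G) →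
      lp.single 1 n (1 : 𝕜) ∈ G := by
    intro n hn
    suffices hs : u n • lp.single 1 n (1 : 𝕜) ∈ G from
      (Submodule.smul_mem_iff _ (hu₀ n)).1 hs
    rw [← SetLike.mem_coe, ← hG.closure_eq, Metric.mem_closure_iff]
    intro ε hε
    -- The error is at most `a (1 - a)⁻¹`, hence at most `2a < ε`.
    obtain ⟨a, ha₀, ha⟩ := exists_between (show (0 : ℝ) < min (1 / 2) (ε / 2) by positivity)
    have ha2 : a < 1 / 2 := ha.trans_le (min_le_left _ _)
    have ha1 : a < 1 := by linarith
    refine ⟨_, hn a ha₀ ha1, ?_⟩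
    rw [dist_comm, dist_eq_norm, geomTail_sub_single, norm_smul, RCLike.norm_ofReal,
      abs_of_pos ha₀]
    have h2 : (1 - a)⁻¹ ≤ 2 := by
      rw [inv_le_comm₀ (by linarith) (by norm_num)]; linarith
    have h3 := mul_le_mul_of_nonneg_left
      ((norm_geomTail_le u hu a ha₀ ha1 (n + 1)).trans h2) ha₀.le
    have h4 : a < ε / 2 := ha.trans_le (min_le_right _ _)
    linarith
  have tail : ∀ n (a : ℝ) (ha₀ : 0 < a) (ha : a < 1), geomTail u hu a ha₀ ha n ∈ G := by
    intro n
    induction n with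
    | zero => exact h
    | succ n ih =>
      intro a ha₀ ha
      have ha' : (a : 𝕜) ≠ 0 := by exact_mod_cast ha₀.ne'
      rw [← Submodule.smul_mem_iff _ ha', ← geomTail_sub_single]
      exact G.sub_mem (ih a ha₀ ha) (G.smul_mem _ (key n ih))
  refine eq_top_iff.2 fun x _ => ?_
  have hx := lp.hasSum_single (p := 1) ENNReal.one_ne_top x
  refine hG.mem_of_tendsto hx (Eventually.of_forall fun s => G.sum_mem fun n _ => ?_)
  have : lp.single 1 n (x n) = (x n) • lp.single (E := fun _ : ℕ => 𝕜) 1 n (1 : 𝕜) := by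
    rw [← lp.single_smul, smul_eq_mul, mul_one]
  rw [this]
  exact G.smul_mem _ (key n (tail n))

end Density

/-! ### Decay of Volterra iterates via a Laguerre equation. -/

section Laguerre

open Polynomial

/-- The polynomial `∑ j, (-1) ^ j * (k choose j) * X ^ j / (j + 1)!`, a multiple of the Laguerre
polynomial with parameter `1`. -/
noncomputable def laguerreOne (k : ℕ) : ℝ[X] :=
  ∑ j ∈ Finset.range (k + 1), monomial j ((-1) ^ j * (k.choose j : ℝ) / (j + 1).factorial)

theorem laguerreOne_coeff (k j : ℕ) :
    (laguerreOne k).coeff j = (-1) ^ j * (k.choose j : ℝ) / (j + 1).factorial := by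
  simp only [laguerreOne, finsetSum_coeff, coeff_monomial, Finset.sum_ite_eq', Finset.mem_range]
  split_ifs with h
  · rfl
  · rw [Nat.choose_eq_zero_of_lt (by omega)]; simp

theorem laguerreOne_coeff_succ (k j : ℕ) :
    ((j : ℝ) + 1) * (j + 2) * (laguerreOne k).coeff (j + 1) =
      ((j : ℝ) - k) * (laguerreOne k).coeff j := by
  have h : (k.choose (j + 1) : ℝ) * (j + 1) = k.choose j * ((k : ℝ) - j) := by
    rcases le_or_gt j k with hj | hj
    · have := Nat.choose_succ_right_eq k j
      rw [← Nat.cast_sub hj]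
      exact_mod_cast this
    · rw [Nat.choose_eq_zero_of_lt hj, Nat.choose_eq_zero_of_lt (by omega)]; simp
  have hf : ((j + 1).factorial : ℝ) ≠ 0 := by positivity
  rw [laguerreOne_coeff, laguerreOne_coeff, Nat.factorial_succ (j + 1), pow_succ]
  push_cast
  have h2 : (j : ℝ) + 1 + 1 ≠ 0 := by positivity
  field_simp
  linear_combination (-(j + 2 : ℝ)) * h

theorem laguerreOne_ode (k : ℕ) :
    X * derivative (derivative (laguerreOne k)) + (2 - X) * derivative (laguerreOne k) +
      C (k : ℝ) * laguerreOne k = 0 := by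
  ext n
  rw [sub_mul, show (2 : ℝ[X]) = C 2 from rfl]
  have h := laguerreOne_coeff_succ k n
  cases n with
  | zero =>
    simp [coeff_derivative] at h ⊢
    linarith
  | succ n =>
    simp [coeff_derivative] at h ⊢
    linear_combination h

/-- The iterate of `1 - W` on the identity function, `W` being the Volterra operator. -/
noncomputable def laguerreIntegral (k : ℕ) : ℝ[X] := X * laguerreOne k

theorem laguerreIntegral_zero : laguerreIntegral 0 = X := by
  simp [laguerreIntegral, laguerreOne]

theorem laguerreIntegral_eval_zero (k : ℕ) : (laguerreIntegral k).eval 0 = 0 := by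
  simp [laguerreIntegral]

/-- Pascal's rule on coefficients. Together with vanishing at `0`, this says that each step applies
`1 - W`. -/
theorem derivative_laguerreIntegral_succ (k : ℕ) :
    derivative (laguerreIntegral (k + 1)) =
      derivative (laguerreIntegral k) - laguerreIntegral k := by
  ext n
  rw [coeff_sub, coeff_derivative, coeff_derivative, laguerreIntegral, laguerreIntegral,
    coeff_X_mul, coeff_X_mul, laguerreOne_coeff, laguerreOne_coeff]
  cases n with
  | zero => simp
  | succ n =>
    have hf : ((n + 1).factorial : ℝ) ≠ 0 := by positivity
    have h2 : (n : ℝ) + 1 + 1 ≠ 0 := by positivity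
    rw [coeff_X_mul, laguerreOne_coeff, Nat.choose_succ_succ, Nat.factorial_succ (n + 1), pow_succ]
    push_cast
    field_simp
    ring

theorem sq_eval_laguerreIntegral_le (k : ℕ) {u : ℝ} (hu : 0 ≤ u) :
    ((laguerreIntegral k).eval u) ^ 2 ≤ u * Real.exp (2 * u) / (k + 1) := by
  set R := laguerreOne k with hR
  -- An energy: with `F = X * R`, the Laguerre equation reads `F'' - F' + (k + 1) F / X = 0`, and `G
  -- = (k + 1) F² / X + F'²`. The factor `exp (-2v)` absorbs the growth from the term `-F'`.
  let G : ℝ[X] := C ((k : ℝ) + 1) * (X * R ^ 2) + (R + X * derivative R) ^ 2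
  let f : ℝ → ℝ := fun v => G.eval v * Real.exp (-2 * v)
  have hG : derivative G = 2 * G - C ((k : ℝ) + 1) * R ^ 2 * (1 + 2 * X) := by
    have hode := laguerreOne_ode k
    rw [← hR, C_eq_natCast] at hode
    simp only [G, derivative_mul, derivative_X, derivative_pow,
      map_add, map_one, C_eq_natCast]
    norm_num
    linear_combination (2 * (R + X * derivative R)) * hode
  have hf : ∀ v, HasDerivAt f (-(((k : ℝ) + 1) * (R.eval v) ^ 2 * (1 + 2 * v)) *
      Real.exp (-2 * v)) v := by
    intro v
    have h1 := (G.hasDerivAt v).mul (((hasDerivAt_id v).const_mul (-2 : ℝ)).exp)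
    refine h1.congr_deriv ?_
    rw [hG]
    simp
    ring
  have hanti : AntitoneOn f (Set.Ici 0) := by
    refine antitoneOn_of_deriv_nonpos (convex_Ici 0)
      (fun v _ => (hf v).continuousAt.continuousWithinAt)
      (fun v _ => (hf v).differentiableAt.differentiableWithinAt) fun v hv => ?_
    rw [interior_Ici, Set.mem_Ioi] at hv
    rw [(hf v).deriv, neg_mul]
    exact neg_nonpos.2 (by positivity)
  have h0 : f 0 = 1 := by
    have : R.eval 0 = 1 := by
      rw [← coeff_zero_eq_eval_zero, hR, laguerreOne_coeff]; simp
    simp [f, G, this]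
  have h1 : f u ≤ 1 := h0 ▸ hanti Set.self_mem_Ici hu hu
  have h2 : G.eval u ≤ Real.exp (2 * u) := by
    have := mul_le_mul_of_nonneg_right h1 (Real.exp_pos (2 * u)).le
    simpa [f, mul_assoc, ← Real.exp_add] using this
  rw [le_div_iff₀ (by positivity)]
  have h3 : ((k : ℝ) + 1) * (u * (R.eval u) ^ 2) ≤ G.eval u := by
    simp only [G, eval_add, eval_mul, eval_C, eval_X, eval_pow]
    have := sq_nonneg (eval u R + u * eval u (derivative R))
    linarith
  have h4 := mul_le_mul_of_nonneg_left (h3.trans h2) hu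
  simp only [laguerreIntegral, eval_mul, eval_X, ← hR]
  linarith

end Laguerre

/-! ### Moment sequences, on which the weighted shift acts as integration. -/

section Moments

open Polynomial

/-- The moments `∫ t in 0..a, t ^ n * P (a - t)` of a reflected polynomial. -/
noncomputable def reflectedMoment (a : ℝ) (P : ℝ[X]) (n : ℕ) : ℝ :=
  ∫ t in (0 : ℝ)..a, t ^ n * P.eval (a - t)

theorem intervalIntegrable_pow_mul_eval_sub (a : ℝ) (P : ℝ[X]) (n : ℕ) :
    IntervalIntegrable (fun t => t ^ n * P.eval (a - t)) MeasureTheory.volume 0 a :=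
  Continuous.intervalIntegrable (by fun_prop) 0 a

theorem reflectedMoment_sub (a : ℝ) (P Q : ℝ[X]) (n : ℕ) :
    reflectedMoment a (P - Q) n = reflectedMoment a P n - reflectedMoment a Q n := by
  rw [reflectedMoment, reflectedMoment, reflectedMoment, ← intervalIntegral.integral_sub
    (intervalIntegrable_pow_mul_eval_sub a P n) (intervalIntegrable_pow_mul_eval_sub a Q n)]
  simp only [eval_sub, mul_sub]

theorem reflectedMoment_C_mul (a c : ℝ) (P : ℝ[X]) (n : ℕ) :
    reflectedMoment a (C c * P) n = c * reflectedMoment a P n := by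
  rw [reflectedMoment, reflectedMoment, ← intervalIntegral.integral_const_mul]
  simp only [eval_mul, eval_C, mul_left_comm]

/-- Integration by parts; the boundary terms vanish because of `t ^ (n + 1)` at `0` and `P.eval 0 =
0` at `t = a`. -/
theorem reflectedMoment_derivative (a : ℝ) {P : ℝ[X]} (hP : P.eval 0 = 0) (n : ℕ) :
    reflectedMoment a (derivative P) (n + 1) = (n + 1) * reflectedMoment a P n := by
  have hd : ∀ t ∈ Set.uIcc 0 a, HasDerivAt (fun t : ℝ => t ^ (n + 1) * P.eval (a - t))
      ((n + 1) * (t ^ n * P.eval (a - t)) - t ^ (n + 1) * (derivative P).eval (a - t)) t := by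
    intro t _
    have h1 := (hasDerivAt_pow (n + 1) t).mul
      ((P.hasDerivAt (a - t)).comp t ((hasDerivAt_id t).const_sub a))
    refine h1.congr_deriv ?_
    simp
    ring
  have hi := (intervalIntegrable_pow_mul_eval_sub a P n).const_mul (n + 1 : ℝ)
  have hj := intervalIntegrable_pow_mul_eval_sub a (derivative P) (n + 1)
  have h := intervalIntegral.integral_eq_sub_of_hasDerivAt hd (hi.sub hj)
  rw [intervalIntegral.integral_sub hi hj, intervalIntegral.integral_const_mul] at h
  simp only [sub_self, hP, mul_zero, ne_eq, Nat.add_eq_zero_iff, one_ne_zero, and_false,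
    not_false_eq_true, zero_pow, zero_mul] at h
  rw [reflectedMoment, reflectedMoment]
  linarith

theorem abs_reflectedMoment_le {a K : ℝ} (ha₀ : 0 < a) (ha : a < 1) {P : ℝ[X]}
    (hP : ∀ v ∈ Set.Icc 0 a, |P.eval v| ≤ K) (n : ℕ) : |reflectedMoment a P n| ≤ K * a ^ n := by
  have hK : 0 ≤ K := (abs_nonneg _).trans (hP 0 ⟨le_rfl, ha₀.le⟩)
  have h : ∀ t ∈ Set.uIoc 0 a, ‖t ^ n * P.eval (a - t)‖ ≤ K * a ^ n := by
    intro t ht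
    rw [Set.uIoc_of_le ha₀.le, Set.mem_Ioc] at ht
    rw [norm_mul, mul_comm, norm_pow, Real.norm_eq_abs, Real.norm_eq_abs, abs_of_pos ht.1]
    exact mul_le_mul (hP _ ⟨by linarith, by linarith⟩)
      (pow_le_pow_left₀ ht.1.le ht.2 n) (by have := ht.1; positivity) hK
  refine (intervalIntegral.norm_integral_le_of_norm_le_const h).trans ?_
  rw [sub_zero, abs_of_pos ha₀]
  exact mul_le_of_le_one_right (by positivity) ha.le

theorem reflectedMoment_X (a : ℝ) (n : ℕ) :
    reflectedMoment a X n = a ^ (n + 2) / ((n + 1) * (n + 2)) := by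
  have h : ∀ t : ℝ, t ^ n * (X : ℝ[X]).eval (a - t) = a * t ^ n - t ^ (n + 1) := fun t => by
    rw [eval_X]; ring
  simp only [reflectedMoment, h]
  rw [intervalIntegral.integral_sub (Continuous.intervalIntegrable (by fun_prop) _ _)
    (Continuous.intervalIntegrable (by fun_prop) _ _), intervalIntegral.integral_const_mul,
    integral_pow, integral_pow]
  have h1 : (n : ℝ) + 1 ≠ 0 := by positivity
  have h2 : (n : ℝ) + 2 ≠ 0 := by positivity
  have h3 : (n : ℝ) + 1 + 1 ≠ 0 := by positivity
  push_cast
  field_simp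
  ring

variable {𝕜 : Type*} [RCLike 𝕜]

theorem norm_rotated_moment_le {ω : 𝕜} (hω : ‖ω‖ = 1) {a K : ℝ} (ha₀ : 0 < a) (ha : a < 1)
    {P : ℝ[X]} (hP : ∀ v ∈ Set.Icc 0 a, |P.eval v| ≤ K) (n : ℕ) :
    ‖ω ^ n * (reflectedMoment a P n : 𝕜)‖ ≤ K * a ^ n := by
  rw [norm_mul, norm_pow, hω, one_pow, one_mul, RCLike.norm_ofReal]
  exact abs_reflectedMoment_le ha₀ ha hP n

/-- The element of `ℓ₁` with entries `ω ^ n * ∫ t in 0..a, t ^ n * P (a - t)`. -/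
noncomputable def momentVec (ω : 𝕜) (hω : ‖ω‖ = 1) (a : ℝ) (ha₀ : 0 < a) (ha : a < 1)
    (P : ℝ[X]) : EllOne 𝕜 :=
  ⟨fun n => ω ^ n * (reflectedMoment a P n : 𝕜), by
    obtain ⟨K, hK⟩ := isCompact_Icc.exists_bound_of_continuousOn (s := Set.Icc 0 a)
      (f := fun v => P.eval v) (by fun_prop)
    exact memℓp_one_of_norm_le_geometric ha₀.le ha (norm_rotated_moment_le hω ha₀ ha hK)⟩

theorem momentVec_apply (ω : 𝕜) (hω : ‖ω‖ = 1) (a : ℝ) (ha₀ : 0 < a) (ha : a < 1) (P : ℝ[X])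
    (n : ℕ) : momentVec ω hω a ha₀ ha P n = ω ^ n * (reflectedMoment a P n : 𝕜) := rfl

theorem norm_momentVec_le {ω : 𝕜} (hω : ‖ω‖ = 1) {a K : ℝ} (ha₀ : 0 < a) (ha : a < 1)
    {P : ℝ[X]} (hP : ∀ v ∈ Set.Icc 0 a, |P.eval v| ≤ K) :
    ‖momentVec ω hω a ha₀ ha P‖ ≤ K * (1 - a)⁻¹ :=
  EllOne.norm_le_of_norm_le_geometric ha₀.le ha (norm_rotated_moment_le hω ha₀ ha hP)

/-- The backward shift with weights `1 / n`. -/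
noncomputable abbrev harmonicShift (𝕜 : Type*) [RCLike 𝕜] : EllOne 𝕜 →L[𝕜] EllOne 𝕜 :=
  backwardShift (fun n : ℕ => 1 / (n : 𝕜)) (one_div_weights_bounded 𝕜)

theorem one_sub_smul_harmonicShift_apply (lam : 𝕜) (x : EllOne 𝕜) (n : ℕ) :
    ((1 - lam • harmonicShift 𝕜 : EllOne 𝕜 →L[𝕜] EllOne 𝕜) x) n =
      x n - lam * (1 / ((n + 1 : ℕ) : 𝕜) * x (n + 1)) := rfl

/-- The hypotheses on `Q` encode `Q = P - c ∫₀ P`; the weight `1 / (n + 1)` cancels the factor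
produced by integration by parts. -/
theorem one_sub_smul_harmonicShift_momentVec {lam ω : 𝕜} {c : ℝ} (hω : ‖ω‖ = 1)
    (hc : lam * ω = (c : 𝕜)) {a : ℝ} (ha₀ : 0 < a) (ha : a < 1) {P Q : ℝ[X]}
    (hP : P.eval 0 = 0) (hQ : Q.eval 0 = 0) (h : derivative Q = derivative P - C c * P) :
    (1 - lam • harmonicShift 𝕜) (momentVec ω hω a ha₀ ha P) = momentVec ω hω a ha₀ ha Q := by
  ext n
  rw [one_sub_smul_harmonicShift_apply, momentVec_apply, momentVec_apply, momentVec_apply]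
  have h1 : c * reflectedMoment a P (n + 1) =
      (n + 1) * (reflectedMoment a P n - reflectedMoment a Q n) := by
    rw [← reflectedMoment_C_mul, ← reflectedMoment_sub, ← reflectedMoment_derivative a
      (by rw [eval_sub, hP, hQ, sub_zero]), derivative_sub, h, sub_sub_cancel]
  have h2 : (c : 𝕜) * (reflectedMoment a P (n + 1) : 𝕜) =
      (n + 1) * ((reflectedMoment a P n : 𝕜) - (reflectedMoment a Q n : 𝕜)) := by
    exact_mod_cast congrArg (RCLike.ofReal (K := 𝕜)) h1
  have hn : (n : 𝕜) + 1 ≠ 0 := by exact_mod_cast n.succ_ne_zero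
  rw [← hc] at h2
  push_cast
  field_simp
  rw [pow_succ]
  linear_combination (-ω ^ n) * h2

theorem one_sub_smul_harmonicShift_pow_momentVec {lam ω : 𝕜} {c : ℝ} (hω : ‖ω‖ = 1)
    (hc : lam * ω = (c : 𝕜)) {a : ℝ} (ha₀ : 0 < a) (ha : a < 1) (k : ℕ) :
    ((1 - lam • harmonicShift 𝕜) ^ k) (momentVec ω hω a ha₀ ha (C c * X)) =
      momentVec ω hω a ha₀ ha ((laguerreIntegral k).comp (C c * X)) := by
  induction k with
  | zero => rw [laguerreIntegral_zero, X_comp]; rfl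
  | succ k ih =>
    rw [pow_succ', mul_apply_eq_comp, ih]
    have h0 : ∀ k, ((laguerreIntegral k).comp (C c * X)).eval 0 = 0 := fun k => by
      simp [eval_comp, laguerreIntegral_eval_zero]
    refine one_sub_smul_harmonicShift_momentVec hω hc ha₀ ha (h0 k) (h0 (k + 1)) ?_
    rw [derivative_comp, derivative_comp, derivative_laguerreIntegral_succ]
    simp [sub_comp, mul_sub]

theorem tendsto_one_sub_smul_harmonicShift_pow_momentVec {lam ω : 𝕜} {c : ℝ} (hc₀ : 0 ≤ c)
    (hω : ‖ω‖ = 1) (hc : lam * ω = (c : 𝕜)) {a : ℝ} (ha₀ : 0 < a) (ha : a < 1) :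
    Tendsto (fun k : ℕ =>
      ((1 - lam • harmonicShift 𝕜) ^ k) (momentVec ω hω a ha₀ ha (C c * X))) atTop (𝓝 0) := by
  have hbound : ∀ k : ℕ, ∀ v ∈ Set.Icc 0 a, |((laguerreIntegral k).comp (C c * X)).eval v| ≤
      √(c * Real.exp (2 * c) * (1 / ((k : ℝ) + 1))) := by
    intro k v hv
    refine Real.abs_le_sqrt ?_
    have hcv : c * v ≤ c := mul_le_of_le_one_right hc₀ (hv.2.trans ha.le)
    rw [eval_comp, eval_mul, eval_C, eval_X, mul_one_div]
    refine (sq_eval_laguerreIntegral_le k (mul_nonneg hc₀ hv.1)).trans ?_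
    gcongr
  simp only [one_sub_smul_harmonicShift_pow_momentVec hω hc ha₀ ha]
  refine squeeze_zero_norm (fun k => norm_momentVec_le hω ha₀ ha (hbound k)) ?_
  have h1 := (tendsto_one_div_add_atTop_nhds_zero_nat (𝕜 := ℝ)).const_mul (c * Real.exp (2 * c))
  simpa using h1.sqrt.mul_const (1 - a)⁻¹

/-- The subspace of vectors whose orbit under `A` tends to zero. -/
def orbitTendstoZero {X : Type*} [NormedAddCommGroup X] [NormedSpace 𝕜 X] (A : X →L[𝕜] X) :
    Submodule 𝕜 X where
  carrier := {x | Tendsto (fun k : ℕ => (A ^ k) x) atTop (𝓝 0)}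
  zero_mem' := by simp
  add_mem' {x y} hx hy := by
    have : Tendsto (fun k : ℕ => (A ^ k) x + (A ^ k) y) atTop (𝓝 (0 + 0)) := hx.add hy
    simpa using this
  smul_mem' c x hx := by
    have : Tendsto (fun k : ℕ => c • (A ^ k) x) atTop (𝓝 (c • 0)) := hx.const_smul c
    rw [smul_zero] at this
    exact this.congr fun k => (map_smul _ _ _).symm

theorem dense_tendsto_one_sub_smul_harmonicShift_pow {lam : 𝕜} (hlam : lam ≠ 0) :
    Dense {x | Tendsto (fun k : ℕ => ((1 - lam • harmonicShift 𝕜) ^ k) x) atTop (𝓝 0)} := by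
  -- The rotation makes the Volterra coefficient positive, whatever the argument of `lam`.
  obtain ⟨ω, hω, hc⟩ : ∃ ω : 𝕜, ‖ω‖ = 1 ∧ lam * ω = ((‖lam‖ : ℝ) : 𝕜) := by
    have hn : ((‖lam‖ : ℝ) : 𝕜) ≠ 0 := by exact_mod_cast norm_ne_zero_iff.2 hlam
    refine ⟨((‖lam‖ : ℝ) : 𝕜) / lam, ?_, mul_div_cancel₀ _ hlam⟩
    rw [norm_div, RCLike.norm_ofReal, abs_norm, div_self (norm_ne_zero_iff.2 hlam)]
  have hω₀ : ω ≠ 0 := norm_ne_zero_iff.1 (by rw [hω]; exact one_ne_zero)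
  let u : ℕ → 𝕜 := fun n => ω ^ n / (((n : 𝕜) + 1) * (n + 2))
  have hn : ∀ n : ℕ, ((n : 𝕜) + 1) * (n + 2) ≠ 0 := fun n => by
    exact_mod_cast (by positivity : (n + 1) * (n + 2) ≠ 0)
  have hu : ∀ n, ‖u n‖ ≤ 1 := fun n => by
    have h1 : ((n : 𝕜) + 1) * (n + 2) = (((n + 1) * (n + 2) : ℕ) : 𝕜) := by push_cast; ring
    rw [norm_div, norm_pow, hω, one_pow, h1, RCLike.norm_natCast]
    refine div_le_one_of_le₀ ?_ (Nat.cast_nonneg _)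
    exact_mod_cast Nat.succ_le_of_lt (by positivity : 0 < (n + 1) * (n + 2))
  have hu₀ : ∀ n, u n ≠ 0 := fun n => div_ne_zero (pow_ne_zero n hω₀) (hn n)
  refine (Submodule.dense_iff_topologicalClosure_eq_top (s := orbitTendstoZero _)).2 ?_
  refine EllOne.eq_top_of_geomTail_mem u hu hu₀ _ (Submodule.isClosed_topologicalClosure _)
    fun a ha₀ ha => Submodule.le_topologicalClosure _ ?_
  have hmem : momentVec ω hω a ha₀ ha (C ‖lam‖ * X) ∈
      orbitTendstoZero (1 - lam • harmonicShift 𝕜) :=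
    tendsto_one_sub_smul_harmonicShift_pow_momentVec (norm_nonneg lam) hω hc ha₀ ha
  have ha' : ((‖lam‖ * a ^ 2 : ℝ) : 𝕜) ≠ 0 := by
    have := norm_pos_iff.2 hlam
    exact_mod_cast (by positivity : ‖lam‖ * a ^ 2 ≠ 0)
  -- The moments of `‖lam‖ X` are `‖lam‖ a^(n+2) / ((n+1)(n+2))`, which fixes both this scalar and
  -- the choice of `u`.
  rw [← Submodule.smul_mem_iff _ ha']
  convert hmem using 1
  ext n
  rw [lp.coeFn_smul, Pi.smul_apply, smul_eq_mul, geomTail_apply, if_neg (Nat.not_lt_zero n),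
    Nat.sub_zero, momentVec_apply, reflectedMoment_C_mul, reflectedMoment_X]
  simp only [u]
  push_cast
  have := hn n
  field_simp
  ring

theorem harmonicShift_commutator (lam : 𝕜) (h1 : ∃ C : ℝ, ∀ n : ℕ, 1 ≤ n → ‖(1 : 𝕜)‖ ≤ C) :
    (lam • harmonicShift 𝕜) * (lam • backwardShift (fun _ => 1) h1) -
      (lam • backwardShift (fun _ => 1) h1) * (lam • harmonicShift 𝕜) =
      (lam • harmonicShift 𝕜) * (lam • harmonicShift 𝕜) := by
  ext x n
  change lam * (1 / ((n + 1 : ℕ) : 𝕜) * (lam * (1 * x (n + 1 + 1)))) -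
    lam * (1 * (lam * (1 / ((n + 1 + 1 : ℕ) : 𝕜) * x (n + 1 + 1)))) =
    lam * (1 / ((n + 1 : ℕ) : 𝕜) * (lam * (1 / ((n + 1 + 1 : ℕ) : 𝕜) * x (n + 1 + 1))))
  have hn : (n : 𝕜) + 1 ≠ 0 := by exact_mod_cast n.succ_ne_zero
  have hn2 : (n : 𝕜) + 1 + 1 ≠ 0 := by exact_mod_cast (n + 1).succ_ne_zero
  push_cast
  field_simp
  ring

end Moments

theorem mainTheorem6 {𝕜 : Type*} [RCLike 𝕜] (lam : 𝕜) (hlam : lam ≠ 0) :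
    SatisfiesKitaiCriterion
      (ContinuousLinearMap.id 𝕜 (EllOne 𝕜) +
        lam • backwardShift (fun n : ℕ => 1 / (n : 𝕜)) (one_div_weights_bounded 𝕜)) := by
  refine SatisfiesKitaiCriterion.one_add_of_commutator_eq_sq
    (harmonicShift_commutator lam ⟨1, fun _ _ => by simp⟩) ?_
    (dense_tendsto_one_sub_smul_harmonicShift_pow hlam)
  have := dense_tendsto_one_sub_smul_harmonicShift_pow (neg_ne_zero.2 hlam)
  simpa only [neg_smul, sub_neg_eq_add] using this
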